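/- Let $\mathbb N=\{1,2,3,\dots\}$, let $u,k,v_1,\dots,v_k\in\mathbb N$ with $k\ge 2$, and for $1\le t\le k$ let $A_t$ be a $u\times v_t$ matrix with entries in $\mathbb Q$. The tuple $(A_1,\dots,A_k)$ is called multiply kernel partition regular (multiply KPR) if for every finite colouring of $\mathbb N$ there are vectors $\vec x_t\in\mathbb N^{v_t}$ $(1\le t\le k)$ such that, for each $t$, the entries of $\vec x_t$ all have the same colour (which may depend on $t$), and $\sum_{t=1}^k A_t\vec x_t=\vec 0$. Let $\beta\mathbb N$ be the set of ultrafilters on $\mathbb N$, with the operation $+$ given by $B\in p+q\iff\{m:\{n:m+n\in B\}\in q\}\in p$. An idempotent of $(\beta\mathbb N,+)$ is called minimal if it lies in the smallest two-sided ideal of $(\beta\mathbb N,+)$. Let $p$ be a minimal idempotent of $(\beta\mathbb N,+)$. Then $(A_1,\dots,A_k)$ is multiply KPR if and only if there exist positive rationals $c_1=1,c_2,\dots,c_k$ and minimal idempotents $p_1=p,p_2,\dots,p_k$ of $(\beta\mathbb N,+)$ with the following property: whenever $C_t\in p_t$ for $1\le t\le k$, there are vectors $\vec x_t\in C^{v_t}$,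 where $C=\bigcap_{s=1}^k c_s^{-1}C_s=\{n\in\mathbb N: c_sn\in C_s\text{ for all }s\}$, such that for each $t$ all entries of $c_t\vec x_t$ are in $C_t$, and $\sum_{t=1}^k A_tc_t\vec x_t=\vec 0$. Moreover, if $(A_1,\dots,A_k)$ is multiply KPR, then such $c_t$ and $p_t$ can be chosen with $p_t=c_tp$ for every $t$, where $c_tp$ is the image of the ultrafilter $p$ under $n\mapsto c_tn$ (an ultrafilter on $\mathbb Q$, and $\beta\mathbb N$ is regarded as a subset of the set of ultrafilters on $\mathbb Q$). -/

import Mathlib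

open scoped Matrix

/-- The inclusion of the positive integers into the rationals. -/
def posToRat (n : ℕ+) : ℚ := ((n : ℕ) : ℚ)

/-- Matrices `A₁, …, A_k` over `ℚ` with `u` rows each, where `A_t` has `v t` columns, are multiply
kernel partition regular if for every finite colouring of the positive integers there are vectors
`x₁, …, x_k` of positive integers, each of them monochromatic (different vectors may have different
colours), with `A₁ x₁ + ⋯ + A_k x_k = 0`. -/
def MultiplyKPR {u k : ℕ} {v : Fin k → ℕ} (A : ∀ t : Fin k, Matrix (Fin u) (Fin (v t)) ℚ) : Prop :=
  ∀ (r : ℕ) (φ : ℕ+ → Fin r), ∃ x : ∀ t : Fin k, Fin (v t) → ℕ+,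
    (∀ t, ∀ i j : Fin (v t), φ (x t i) = φ (x t j)) ∧
    ∑ t, A t *ᵥ (fun j => posToRat (x t j)) = 0

/-- A (two-sided) ideal of an additively written semigroup: a nonempty subset that absorbs
addition of arbitrary elements on both sides. -/
def IsSemigroupIdeal {S : Type*} [Add S] (I : Set S) : Prop :=
  I.Nonempty ∧ ∀ a ∈ I, ∀ s : S, a + s ∈ I ∧ s + a ∈ I

/-- The smallest ideal of an additively written semigroup, as the intersection of all its ideals.
The semigroup has a smallest ideal exactly when this set is nonempty, and then this set is it. -/
def smallestIdeal (S : Type*) [Add S] : Set S :=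
  ⋂₀ {I : Set S | IsSemigroupIdeal I}

section
attribute [local instance] Ultrafilter.add

/-- The minimal idempotents of `(βℕ, +)`: the idempotents in its smallest ideal. Points of `βℕ` are
ultrafilters on the positive integers, and `B ∈ p + q` iff `{m | {n | m + n ∈ B} ∈ q} ∈ p`. -/
def IsMinimalIdempotent (p : Ultrafilter ℕ+) : Prop :=
  p + p = p ∧ p ∈ smallestIdeal (Ultrafilter ℕ+)

end

/-- For rational `c` and `p ∈ βℕ`, the point `c p` of the Stone-Čech compactification of the
discrete space `ℚ`: the image of `p` under the continuous extension of `n ↦ c n`. -/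
def ratMul (c : ℚ) (p : Ultrafilter ℕ+) : Ultrafilter ℚ :=
  p.map (fun n => c * posToRat n)

/-- The set `c⁻¹ B` of positive integers `n` with `c n ∈ B`. -/
def invDilate (c : ℚ) (B : Set ℕ+) : Set ℕ+ :=
  {n | c * posToRat n ∈ posToRat '' B}

/-- Given members `C₁, …, C_k` of `p₁, …, p_k`, and with `C = c₁⁻¹ C₁ ∩ ⋯ ∩ c_k⁻¹ C_k`, there are
vectors `x_t` with entries in `C`, such that all entries of `c_t x_t` are in `C_t` and
`A₁ c₁ x₁ + ⋯ + A_k c_k x_k = 0`. -/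
def SolvableInMembers {u k : ℕ} {v : Fin k → ℕ} (A : ∀ t : Fin k, Matrix (Fin u) (Fin (v t)) ℚ)
    (c : Fin k → ℚ) (p : Fin k → Ultrafilter ℕ+) : Prop :=
  ∀ C : Fin k → Set ℕ+, (∀ t, C t ∈ p t) →
    ∃ x : ∀ t : Fin k, Fin (v t) → ℕ+,
      (∀ t j, x t j ∈ ⋂ s, invDilate (c s) (C s)) ∧
      (∀ t j, c t * posToRat (x t j) ∈ posToRat '' C t) ∧
      ∑ t, A t *ᵥ (c t • fun j => posToRat (x t j)) = 0

/-! The substance is that a multiply KPR tuple satisfies the columns condition once each `A_t` is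
scaled by a suitable positive rational `c_t`; the scaled system is then solvable in every member of
`p`. As `c_t p` is again a minimal idempotent, `p_t = c_t p` works. Conversely, each `p_t` contains
a colour class.

To find the weights, colour by `log x` modulo `n` to precision `1/n`, and order the columns by
growth of the solutions along an ultrafilter as `n → ∞`. Within one matrix the logarithms agree
modulo `n` in the limit; columns of comparable growth have convergent ratios; `exists_potential`
reconciles both into one real weight per matrix. Dividing the equation by one variable, modulo the
span of the faster columns, gives the columns condition in the limit. A `ℚ`-linear functional
positive on the weights makes them rational.

For solvability, `exists_idempotent_forms` builds an idempotent on integer sequences coordinate by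
coordinate; minimality of `p` forces every required linear form to carry it to `p`. -/

open Filter Topology

/-! ### Minimal left ideals and idempotents in compact right topological semigroups. -/

section RightTopologicalSemigroup

variable {S : Type*} [AddSemigroup S]

/-- A nonempty subset of an additive semigroup that absorbs addition on the left. -/
structure IsLeftIdeal {S : Type*} [Add S] (L : Set S) : Prop where
  nonempty : L.Nonempty
  add_mem : ∀ (s : S), ∀ a ∈ L, s + a ∈ L

/-- A left ideal that is generated by each of its elements. -/
structure IsMinimalLeftIdeal {S : Type*} [Add S] (L : Set S) : Prop extends IsLeftIdeal L where
  exists_add_eq : ∀ a ∈ L, ∀ b ∈ L, ∃ s : S, s + a = b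

/-- `L + S` is an ideal, and right translates of `L` are again minimal left ideals. -/
theorem IsMinimalLeftIdeal.exists_mem_of_mem_smallestIdeal {L : Set S} (hL : IsMinimalLeftIdeal L)
    {p : S} (hp : p ∈ smallestIdeal S) : ∃ L' : Set S, IsMinimalLeftIdeal L' ∧ p ∈ L' := by
  have hI : IsSemigroupIdeal {x : S | ∃ a ∈ L, ∃ s, x = a + s} := by
    obtain ⟨a, ha⟩ := hL.nonempty
    refine ⟨⟨a + a, a, ha, a, rfl⟩, ?_⟩
    rintro _ ⟨b, hb, s, rfl⟩ t
    exact ⟨⟨b, hb, s + t, add_assoc _ _ _⟩, ⟨t + b, hL.add_mem t b hb, s, (add_assoc _ _ _).symm⟩⟩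
  obtain ⟨a, ha, s, rfl⟩ := hp _ hI
  refine ⟨(· + s) '' L, ⟨⟨⟨_, a, ha, rfl⟩, ?_⟩, ?_⟩, a, ha, rfl⟩
  · rintro t _ ⟨b, hb, rfl⟩
    exact ⟨t + b, hL.add_mem t b hb, add_assoc _ _ _⟩
  · rintro _ ⟨b, hb, rfl⟩ _ ⟨d, hd, rfl⟩
    obtain ⟨t, rfl⟩ := hL.exists_add_eq b hb d hd
    exact ⟨t, (add_assoc _ _ _).symm⟩

theorem IsMinimalLeftIdeal.subset_smallestIdeal {L : Set S} (hL : IsMinimalLeftIdeal L) :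
    L ⊆ smallestIdeal S := by
  rintro b hb I ⟨⟨a, ha⟩, hI⟩
  obtain ⟨l, hl⟩ := hL.nonempty
  obtain ⟨s, rfl⟩ := hL.exists_add_eq (a + l) (hL.add_mem a l hl) b hb
  exact (hI _ (hI a ha l).1 s).2

variable [TopologicalSpace S] [CompactSpace S] [T2Space S]

/-- In a compact right topological semigroup every closed left ideal contains a closed minimal left
ideal. -/
theorem IsLeftIdeal.exists_minimal (hS : ∀ r : S, Continuous (· + r)) {N : Set S}
    (hN : IsLeftIdeal N) (hNc : IsClosed N) : ∃ L ⊆ N, IsClosed L ∧ IsMinimalLeftIdeal L := by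
  obtain ⟨L, hLN, hL⟩ := zorn_superset_nonempty {L : Set S | IsClosed L ∧ IsLeftIdeal L} (by
    intro c hc hchain hne
    refine ⟨⋂₀ c, ⟨isClosed_sInter fun t ht => (hc ht).1, ?_, ?_⟩,
      fun s hs => Set.sInter_subset_of_mem hs⟩
    · exact IsCompact.nonempty_sInter_of_directed_nonempty_isCompact_isClosed (hS := hne.to_subtype)
        (IsChain.directedOn hchain.symm) (fun t ht => (hc ht).2.nonempty)
        (fun t ht => (hc ht).1.isCompact) (fun t ht => (hc ht).1)
    · intro s a ha t ht
      exact (hc ht).2.add_mem s a (ha t ht)) N ⟨hNc, hN⟩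
  refine ⟨L, hLN, hL.prop.1, hL.prop.2, ?_⟩
  intro a ha b hb
  have : (Set.range fun s : S => s + a) = L := by
    refine hL.eq_of_subset ⟨(isCompact_range (hS a)).isClosed, ⟨a + a, a, rfl⟩, ?_⟩ ?_
    · rintro s _ ⟨t, rfl⟩
      exact ⟨s + t, add_assoc _ _ _⟩
    · rintro _ ⟨s, rfl⟩
      exact hL.prop.2.add_mem s a ha
  rw [← this] at hb
  exact hb

/-- In a compact right topological semigroup, an idempotent is in the smallest ideal if and only if
it is minimal for the usual partial order on idempotents. -/
theorem idempotent_mem_smallestIdeal_iff (hS : ∀ r : S, Continuous (· + r)) {p : S}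
    (hp : p + p = p) :
    p ∈ smallestIdeal S ↔ ∀ e : S, e + e = e → e + p = e → p + e = e → e = p := by
  constructor
  · intro h e hee hep hpe
    obtain ⟨L, -, -, hL⟩ := IsLeftIdeal.exists_minimal hS (N := Set.univ)
      ⟨⟨p, trivial⟩, fun _ _ _ => trivial⟩ isClosed_univ
    obtain ⟨L', hL', hpL⟩ := hL.exists_mem_of_mem_smallestIdeal h
    have heL : e ∈ L' := hep ▸ hL'.add_mem e p hpL
    -- From `p = x + e` it follows that `p + e = p`.
    obtain ⟨x, hx⟩ := hL'.exists_add_eq e heL p hpL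
    rw [← hpe, ← hx, add_assoc, hee]
  · intro h
    obtain ⟨L, hLs, hLc, hL⟩ := IsLeftIdeal.exists_minimal hS (N := Set.range fun s : S => s + p)
      ⟨⟨p + p, p, rfl⟩, by rintro s _ ⟨t, rfl⟩; exact ⟨s + t, add_assoc _ _ _⟩⟩
      (isCompact_range (hS p)).isClosed
    obtain ⟨g, hgL, hg⟩ := exists_idempotent_in_compact_add_subsemigroup hS L hL.nonempty
      hLc.isCompact (fun x _ y hy => hL.add_mem x y hy)
    obtain ⟨t, ht⟩ := hLs hgL
    have hgp : g + p = g := by rw [← ht]; simp only [add_assoc, hp]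
    -- `p + g` is an idempotent below `p`, and it lies in `L`.
    have he : p + g = p := by
      refine h (p + g) ?_ ?_ ?_
      · rw [add_assoc, ← add_assoc g, hgp, hg]
      · rw [add_assoc, hgp]
      · rw [← add_assoc, hp]
    exact hL.subset_smallestIdeal (he ▸ hL.add_mem p g hgL)

/-- If a closed subsemigroup absorbs addition of an idempotent `f` on both sides, it has an
idempotent below `f`. -/
theorem exists_idempotent_below (hS : ∀ r : S, Continuous (· + r)) {F : Set S} (hF : IsClosed F)
    (hne : F.Nonempty) (hFF : ∀ x ∈ F, ∀ y ∈ F, x + y ∈ F) {f : S} (hf : f + f = f)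
    (hl : ∀ x ∈ F, f + x ∈ F) (hr : ∀ x ∈ F, x + f ∈ F) :
    ∃ e ∈ F, e + e = e ∧ e + f = e ∧ f + e = e := by
  -- Elements of `F + f` absorb `f` on the right; adding `f` on the left to an idempotent there
  -- gives absorption on both sides.
  obtain ⟨_, ⟨g, hgF, rfl⟩, hg⟩ := exists_idempotent_in_compact_add_subsemigroup hS
    ((· + f) '' F) (hne.image _) (hF.isCompact.image (hS f)) (by
      rintro _ ⟨x, hx, rfl⟩ _ ⟨y, hy, rfl⟩
      exact ⟨x + f + y, hFF _ (hr x hx) _ hy, add_assoc _ _ _⟩)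
  have hgf : (g + f) + f = g + f := by rw [add_assoc, hf]
  refine ⟨f + (g + f), hl _ (hr _ hgF), ?_, ?_, ?_⟩
  · simp only at hg
    calc f + (g + f) + (f + (g + f)) = f + ((g + f + f) + (g + f)) := by simp only [add_assoc]
      _ = f + (g + f) := by rw [hgf, hg]
  · rw [add_assoc, hgf]
  · rw [← add_assoc, hf]

end RightTopologicalSemigroup

/-! ### Idempotent ultrafilters, homomorphisms and dilations. -/

section UltrafilterSemigroup

attribute [local instance] Ultrafilter.add Ultrafilter.addSemigroup

namespace Ultrafilter

theorem map_add_hom {M N : Type*} [Add M] [Add N] {h : M → N} (hh : ∀ a b, h (a + b) = h a + h b)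
    (U V : Ultrafilter M) : (U + V).map h = U.map h + V.map h := by
  apply Ultrafilter.coe_injective
  apply Filter.ext'
  intro P
  rw [Ultrafilter.eventually_add]
  change (∀ᶠ m in ↑(U + V), P (h m)) ↔ ∀ᶠ m in U, ∀ᶠ m' in V, P (h m + h m')
  rw [Ultrafilter.eventually_add]
  simp only [hh]

theorem map_injective {α β : Type*} {h : α → β} (hh : Function.Injective h) :
    Function.Injective (Ultrafilter.map h) := by
  intro U V hUV
  apply Ultrafilter.coe_injective
  apply Filter.map_injective hh
  rw [← Ultrafilter.coe_map, ← Ultrafilter.coe_map, hUV]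

theorem exists_map_eq {α β : Type*} {h : α → β} (hh : Function.Injective h) {U : Ultrafilter β}
    (hU : Set.range h ∈ U) : ∃ V : Ultrafilter α, V.map h = U := by
  refine ⟨U.comap hh hU, Ultrafilter.coe_injective ?_⟩
  rw [Ultrafilter.coe_map, Ultrafilter.coe_comap]
  exact Filter.map_comap_of_mem hU

theorem continuous_map {α β : Type*} (h : α → β) : Continuous (Ultrafilter.map h) :=
  ultrafilterBasis_is_basis.continuous_iff.2 <| Set.forall_mem_range.mpr fun s ↦
    ultrafilter_isOpen_basic (h ⁻¹' s)

theorem add_pure_zero {M : Type*} [AddMonoid M] (U : Ultrafilter M) : U + pure 0 = U := by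
  apply Ultrafilter.coe_injective
  apply Filter.ext'
  intro P
  rw [Ultrafilter.eventually_add]
  simp

theorem pure_zero_add {M : Type*} [AddMonoid M] (U : Ultrafilter M) : pure 0 + U = U := by
  apply Ultrafilter.coe_injective
  apply Filter.ext'
  intro P
  rw [Ultrafilter.eventually_add]
  simp

/-- An idempotent over a given idempotent in the image of a homomorphism, and below a given
idempotent in its kernel. -/
theorem exists_idempotent_lift_below {M N : Type*} [AddMonoid M] [AddMonoid N] (π : M →+ N)
    {q f : Ultrafilter M} (hq : q + q = q) (hf : f + f = f) (hπ : f.map π = pure 0) :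
    ∃ e : Ultrafilter M, e.map π = q.map π ∧ e + e = e ∧ e + f = e ∧ f + e = e := by
  have hadd := map_add_hom (map_add π)
  have hqq : q.map π + q.map π = q.map π := by rw [← hadd, hq]
  exact exists_idempotent_below Ultrafilter.continuous_add_left
    (F := {e : Ultrafilter M | e.map π = q.map π})
    (isClosed_singleton.preimage (continuous_map π)) ⟨q, rfl⟩
    (fun x (hx : _ = _) y (hy : _ = _) => by
      change (x + y).map π = _
      rw [hadd, hx, hy, hqq]) hf
    (fun x (hx : _ = _) => by
      change (f + x).map π = _
      rw [hadd, hx, hπ, pure_zero_add])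
    (fun x (hx : _ = _) => by
      change (x + f).map π = _
      rw [hadd, hx, hπ, add_pure_zero])

/-- An idempotent ultrafilter contains the preimage of zero under every homomorphism to a finite
group. -/
theorem map_eq_pure_zero_of_idempotent {M G : Type*} [Add M] [AddGroup G] [Finite G] {h : M → G}
    (hh : ∀ a b, h (a + b) = h a + h b) {U : Ultrafilter M} (hU : U + U = U) :
    ∀ᶠ m in U, h m = 0 := by
  obtain ⟨g, hg⟩ := Ultrafilter.eq_pure_of_finite (U.map h)
  have h2 : U.map h + U.map h = U.map h := by rw [← map_add_hom hh, hU]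
  have h3 : ∀ᶠ x in ((U.map h : Ultrafilter G) : Filter G), x = g := by rw [hg]; simp
  have h4 := h3
  rw [← h2, hg, Ultrafilter.eventually_add] at h4
  simp at h4
  rw [h4] at h3
  exact h3

end Ultrafilter

theorem isMinimalIdempotent_iff {p : Ultrafilter ℕ+} : IsMinimalIdempotent p ↔
    p + p = p ∧ ∀ e : Ultrafilter ℕ+, e + e = e → e + p = e → p + e = e → e = p := by
  constructor
  · rintro ⟨h, h'⟩
    exact ⟨h, (idempotent_mem_smallestIdeal_iff Ultrafilter.continuous_add_left h).1 h'⟩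
  · rintro ⟨h, h'⟩
    exact ⟨h, (idempotent_mem_smallestIdeal_iff Ultrafilter.continuous_add_left h).2 h'⟩

/-- Multiples of a fixed positive integer are large for an idempotent ultrafilter. -/
theorem range_mul_mem_of_idempotent {p : Ultrafilter ℕ+} (hp : p + p = p) (a : ℕ+) :
    (Set.range fun n : ℕ+ => a * n) ∈ p := by
  have : NeZero (a : ℕ) := ⟨a.ne_zero⟩
  have h := Ultrafilter.map_eq_pure_zero_of_idempotent (G := ZMod (a : ℕ))
    (h := fun n : ℕ+ => ((n : ℕ) : ZMod (a : ℕ))) (by intro x y; simp) hp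
  filter_upwards [h] with n hn
  rw [ZMod.natCast_eq_zero_iff] at hn
  obtain ⟨b, hb⟩ := PNat.dvd_iff.2 hn
  exact ⟨b, hb.symm⟩

theorem eventually_gt_of_idempotent {p : Ultrafilter ℕ+} (hp : p + p = p) (a : ℕ+) :
    ∀ᶠ n in p, a < n := by
  filter_upwards [range_mul_mem_of_idempotent hp (a + 1)]
  rintro _ ⟨n, rfl⟩
  calc a < a + 1 := PNat.lt_add_right a 1
    _ = (a + 1) * 1 := (mul_one _).symm
    _ ≤ (a + 1) * n := mul_le_mul_right (one_le) _

theorem mul_pnat_injective (a : ℕ+) : Function.Injective fun n : ℕ+ => a * n :=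
  fun _ _ h => mul_left_cancel h

theorem exists_idempotent_map_mul_eq {p : Ultrafilter ℕ+} (hp : p + p = p) (a : ℕ+) :
    ∃ q : Ultrafilter ℕ+, q + q = q ∧ q.map (fun n => a * n) = p := by
  obtain ⟨q, hq⟩ := Ultrafilter.exists_map_eq (mul_pnat_injective a)
    (range_mul_mem_of_idempotent hp a)
  refine ⟨q, Ultrafilter.map_injective (mul_pnat_injective a) ?_, hq⟩
  rw [Ultrafilter.map_add_hom (fun x y => mul_add a x y), hq, hp]

/-- Every idempotent lives on the multiples of `a`, so any idempotent below `a p` is `a d` with `d`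
below `p`. -/
theorem IsMinimalIdempotent.map_mul {p : Ultrafilter ℕ+} (hp : IsMinimalIdempotent p) (a : ℕ+) :
    IsMinimalIdempotent (p.map fun n => a * n) := by
  rw [isMinimalIdempotent_iff] at hp ⊢
  have hadd := Ultrafilter.map_add_hom (fun x y => mul_add a x y)
  refine ⟨by rw [← hadd, hp.1], fun e he hep hpe => ?_⟩
  obtain ⟨d, hd, rfl⟩ := exists_idempotent_map_mul_eq he a
  rw [← hadd] at hep hpe
  rw [hp.2 d hd (Ultrafilter.map_injective (mul_pnat_injective a) hep)
    (Ultrafilter.map_injective (mul_pnat_injective a) hpe)]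

theorem IsMinimalIdempotent.of_map_mul {p : Ultrafilter ℕ+} {a : ℕ+}
    (hp : IsMinimalIdempotent (p.map fun n => a * n)) : IsMinimalIdempotent p := by
  rw [isMinimalIdempotent_iff] at hp ⊢
  have hadd := Ultrafilter.map_add_hom (fun x y => mul_add a x y)
  have hinj := Ultrafilter.map_injective (mul_pnat_injective a)
  refine ⟨hinj (by rw [hadd, hp.1]), fun e he hep hpe => hinj ?_⟩
  exact hp.2 _ (by rw [← hadd, he]) (by rw [← hadd, hep]) (by rw [← hadd, hpe])

theorem posToRat_injective : Function.Injective posToRat := by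
  intro a b h
  simpa [posToRat] using h

/-- The dilation of a minimal idempotent by a positive rational is a minimal idempotent. -/
theorem IsMinimalIdempotent.exists_map_eq_ratMul {p : Ultrafilter ℕ+} (hp : IsMinimalIdempotent p)
    {c : ℚ} (hc : 0 < c) :
    ∃ q : Ultrafilter ℕ+, IsMinimalIdempotent q ∧ q.map posToRat = ratMul c p := by
  obtain ⟨a, b, rfl⟩ : ∃ a b : ℕ+, c = posToRat a / posToRat b := by
    have hnum := Rat.num_pos.2 hc
    refine ⟨⟨c.num.toNat, by omega⟩, ⟨c.den, c.den_pos⟩, ?_⟩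
    have h1 : ((c.num.toNat : ℕ) : ℚ) = c.num := by
      exact_mod_cast Int.toNat_of_nonneg hnum.le
    simp only [posToRat, PNat.mk_coe]
    rw [h1, Rat.num_div_den]
  obtain ⟨q, -, hq⟩ := exists_idempotent_map_mul_eq (hp.map_mul a).1 b
  refine ⟨q, IsMinimalIdempotent.of_map_mul (a := b) (hq ▸ hp.map_mul a), ?_⟩
  have hb : posToRat b ≠ 0 := by simp [posToRat]
  apply Ultrafilter.map_injective (h := fun x : ℚ => posToRat b * x) (mul_right_injective₀ hb)
  have h := congrArg (Ultrafilter.map posToRat) hq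
  rw [ratMul]
  simp only [Ultrafilter.map_map] at h ⊢
  convert h using 2
  · ext n; simp [posToRat]
  · ext n
    simp only [Function.comp, posToRat, PNat.mul_coe, Nat.cast_mul] at hb ⊢
    field_simp

/-- The inclusion of the positive integers into the integers. -/
def posToInt (n : ℕ+) : ℤ := ((n : ℕ) : ℤ)

/-- In `βℤ`, the idempotents below a minimal idempotent of `βℕ` are equal to it. -/
theorem IsMinimalIdempotent.eq_map_of_below {p : Ultrafilter ℕ+} (hp : IsMinimalIdempotent p)
    {e : Ultrafilter ℤ} (he : e + e = e) (h1 : e + p.map posToInt = e)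
    (h2 : p.map posToInt + e = e) : e = p.map posToInt := by
  rw [isMinimalIdempotent_iff] at hp
  have hinj : Function.Injective posToInt := fun a b h => by simpa [posToInt] using h
  have hadd : ∀ a b : ℕ+, posToInt (a + b) = posToInt a + posToInt b := by
    intro a b; simp [posToInt]
  have hpos : Set.range posToInt ∈ e := by
    -- `e = e + p`, and `p` contains every tail of the positive integers.
    have : ∀ᶠ x : ℤ in e, 0 < x := by
      rw [← h1, Ultrafilter.eventually_add]
      refine Filter.Eventually.of_forall fun m => ?_
      change ∀ᶠ n in p, 0 < m + posToInt n
      filter_upwards [eventually_gt_of_idempotent hp.1 m.natAbs.succPNat] with n hn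
      rw [← PNat.coe_lt_coe, Nat.succPNat_coe] at hn
      rw [posToInt]
      omega
    filter_upwards [this] with x hx
    exact ⟨⟨x.toNat, by omega⟩, by simpa [posToInt] using hx.le⟩
  obtain ⟨d, rfl⟩ := Ultrafilter.exists_map_eq hinj hpos
  rw [← Ultrafilter.map_add_hom hadd] at he h1 h2
  rw [hp.2 d (Ultrafilter.map_injective hinj he) (Ultrafilter.map_injective hinj h1)
    (Ultrafilter.map_injective hinj h2)]

/-- Simultaneous solutions: an idempotent on integer sequences that is carried to `p` by all the
forms `y ↦ ∑ l < m, μ i l * y l` with last nonzero coefficient `N`. -/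
theorem IsMinimalIdempotent.exists_idempotent_forms {p : Ultrafilter ℕ+}
    (hp : IsMinimalIdempotent p) {ι : Type*} (r : ι → ℕ) (μ : ι → ℕ → ℤ) (N : ℕ+)
    (hμr : ∀ i, μ i (r i) = N) (hμ : ∀ i l, r i < l → μ i l = 0) (n m : ℕ) (hmn : m ≤ n) :
    ∃ q : Ultrafilter (ℕ → ℤ), q + q = q ∧ ∀ i, r i < m →
      q.map (fun y => ∑ l ∈ Finset.range n, μ i l * y l) = p.map posToInt := by
  obtain ⟨p', hp', hNp⟩ := exists_idempotent_map_mul_eq hp.1 N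
  induction m with
  | zero =>
    refine ⟨pure 0, Ultrafilter.add_pure_zero _, fun i hi => absurd hi (by omega)⟩
  | succ m ih =>
    obtain ⟨q, hq, hqp⟩ := ih (by omega)
    let π : (ℕ → ℤ) →+ (ℕ → ℤ) :=
      { toFun := fun y l => if l < m then y l else 0
        map_zero' := by ext l; simp
        map_add' := by intro x y; ext l; by_cases h : l < m <;> simp [h] }
    let ι₀ : ℕ+ → ℕ → ℤ := fun n => Pi.single m (n : ℤ)
    have hι₀ : ∀ a b, ι₀ (a + b) = ι₀ a + ι₀ b := by
      intro a b
      simp [ι₀, Pi.single_add]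
    -- `e` agrees with `q` on the coordinates below `m`, and lies below the copy of `p'` on
    -- coordinate `m`.
    obtain ⟨e, heπ, hee, hef, hfe⟩ := Ultrafilter.exists_idempotent_lift_below π hq
      (f := p'.map ι₀) (by rw [← Ultrafilter.map_add_hom hι₀, hp']) (by
        rw [Ultrafilter.map_map, show (⇑π ∘ ι₀) = fun _ => 0 from ?_]
        · apply Ultrafilter.coe_injective
          rw [Ultrafilter.coe_map, Ultrafilter.coe_pure, Filter.map_const]
        · ext n l
          by_cases h : l < m
          · simp [π, ι₀, h, h.ne]
          · simp [π, h])
    refine ⟨e, hee, fun i hi => ?_⟩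
    set h : (ℕ → ℤ) → ℤ := fun y => ∑ l ∈ Finset.range n, μ i l * y l
    have hadd : ∀ x y, h (x + y) = h x + h y := by
      intro x y
      simp [h, mul_add, Finset.sum_add_distrib]
    rcases Nat.lt_succ_iff_lt_or_eq.1 hi with hi | hi
    · have hπ : h = h ∘ π := by
        ext y
        refine Finset.sum_congr rfl fun l _ => ?_
        by_cases hl : l < m
        · simp [π, hl]
        · rw [hμ i l (by omega), zero_mul, zero_mul]
      rw [← hqp i hi, hπ, ← Ultrafilter.map_map, heπ, Ultrafilter.map_map, ← hπ]
    -- The form sends the copy of `p'` to `N p' = p`, so the image of `e` is an idempotent below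
    -- `p`.
    · have hf : (p'.map ι₀).map h = p.map posToInt := by
        rw [← hNp, Ultrafilter.map_map, Ultrafilter.map_map]
        congr 1
        ext a
        simp only [h, ι₀, Function.comp]
        rw [Finset.sum_eq_single m]
        · simp [← hi, hμr, posToInt]
        · intro l _ hl; simp [hl]
        · intro hm; simp at hm; omega
      refine hp.eq_map_of_below ?_ ?_ ?_
      · rw [← Ultrafilter.map_add_hom hadd, hee]
      · rw [← hf, ← Ultrafilter.map_add_hom hadd, hef]
      · rw [← hf, ← Ultrafilter.map_add_hom hadd, hfe]

end UltrafilterSemigroup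

/-! ### Solutions from the columns condition. -/

/-- Every member of a minimal idempotent contains the entries of a solution of each homogeneous
rational system of equations that satisfies the columns condition. -/
theorem IsMinimalIdempotent.exists_solution {p : Ultrafilter ℕ+} (hp : IsMinimalIdempotent p)
    {ι E : Type*} [Fintype ι] [AddCommGroup E] [Module ℚ E] (b : ι → E) (r : ι → ℕ)
    (hb : ∀ l, ∑ i with r i = l, b i ∈ Submodule.span ℚ (b '' {i | l < r i}))
    {C : Set ℕ+} (hC : C ∈ p) :
    ∃ x : ι → ℕ+, (∀ i, x i ∈ C) ∧ ∑ i, posToRat (x i) • b i = 0 := by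
  classical
  -- Each class of the columns condition yields a relation: coefficient one on the class, zero on
  -- lower classes.
  have hrel : ∀ l, ∃ w : ι → ℚ, (∀ i, r i = l → w i = 1) ∧ (∀ i, r i < l → w i = 0) ∧
      ∑ i, w i • b i = 0 := by
    intro l
    obtain ⟨w, hws, hw⟩ := (Finsupp.mem_span_image_iff_linearCombination ℚ).1 (hb l)
    rw [Finsupp.mem_supported'] at hws
    refine ⟨fun i => (if r i = l then 1 else 0) - w i, fun i hi => ?_, fun i hi => ?_, ?_⟩
    · simp [hi, hws i (by simp [hi])]
    · simp [hi.ne, hws i (by simp [hi.le])]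
    · rw [Finsupp.linearCombination_apply, Finsupp.sum_fintype _ _ (by simp)] at hw
      simp only [sub_smul, Finset.sum_sub_distrib, hw, ite_smul, one_smul, zero_smul,
        Finset.sum_filter, sub_self]
  choose w hw1 hw0 hw using hrel
  obtain ⟨n, hn⟩ : ∃ n, ∀ i, r i < n :=
    ⟨Finset.univ.sup r + 1, fun i => Nat.lt_succ_of_le (Finset.le_sup (Finset.mem_univ i))⟩
  obtain ⟨N, hN⟩ : ∃ N : ℕ+, ∀ l < n, ∀ i, ∃ z : ℤ, (z : ℚ) = N * w l i := by
    let D : ℕ := ∏ l ∈ Finset.range n, ∏ i, (w l i).den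
    refine ⟨⟨D, Finset.prod_pos fun l _ => Finset.prod_pos fun i _ => (w l i).den_pos⟩,
      fun l hl i => ?_⟩
    obtain ⟨d, hd⟩ : (w l i).den ∣ D :=
      (Finset.dvd_prod_of_mem (fun i => (w l i).den) (Finset.mem_univ i)).trans
        (Finset.dvd_prod_of_mem (fun l => ∏ i, (w l i).den) (Finset.mem_range.2 hl))
    refine ⟨d * (w l i).num, ?_⟩
    rw [PNat.mk_coe, hd]
    push_cast
    rw [mul_comm ((w l i).den : ℚ), mul_assoc, mul_comm ((w l i).den : ℚ), Rat.mul_den_eq_num]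
  choose! z hz using hN
  -- `z l i` is unspecified for `l ≥ n`, hence the explicit cutoff above `r i`.
  obtain ⟨q, -, hq⟩ := hp.exists_idempotent_forms r (fun i l => if r i < l then 0 else z l i) N
    (fun i => by
      have : (z (r i) i : ℚ) = (N : ℕ) := by rw [hz _ (hn i), hw1 _ _ rfl, mul_one]
      simpa using mod_cast this) (fun i l hl => by simp [hl]) n n le_rfl
  have hev : ∀ᶠ y : ℕ → ℤ in q, ∀ i, ∃ x ∈ C, posToInt x =
      ∑ l ∈ Finset.range n, (if r i < l then 0 else z l i) * y l := by
    rw [Filter.eventually_all]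
    intro i
    have : posToInt '' C ∈ p.map posToInt := Filter.image_mem_map hC
    rw [← hq i (hn i)] at this
    exact this
  obtain ⟨y, hy⟩ := hev.exists
  choose x hxC hx using hy
  refine ⟨x, hxC, ?_⟩
  have hx' : ∀ i, posToRat (x i) = ∑ l ∈ Finset.range n, N * y l * w l i := by
    intro i
    have h1 : posToRat (x i) = (posToInt (x i) : ℚ) := by simp [posToRat, posToInt]
    rw [h1, hx, Int.cast_sum]
    refine Finset.sum_congr rfl fun l hl => ?_
    split_ifs with h
    · simp [hw0 l i h]
    · rw [Int.cast_mul, hz l (Finset.mem_range.1 hl)]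
      ring
  simp only [hx', Finset.sum_smul, mul_smul]
  rw [Finset.sum_comm]
  simp only [← Finset.smul_sum, hw, smul_zero, Finset.sum_const_zero]

/-! ### Weights from colourings by logarithms. -/

/-- Finitely many positive reals are mapped to positive rationals by some `ℚ`-linear functional. -/
theorem exists_rat_linear_pos {κ : Type*} [Finite κ] (c : κ → ℝ) (hc : ∀ t, 0 < c t) :
    ∃ g : ℝ →ₗ[ℚ] ℚ, ∀ t, 0 < g (c t) := by
  let B := Module.Basis.ofVectorSpace ℚ ℝ
  -- Positivity is an open condition on the values at a Hamel basis. The true basis vectors satisfy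
  -- it, hence so does some rational choice by density.
  let F : κ → (Module.Basis.ofVectorSpaceIndex ℚ ℝ → ℝ) → ℝ :=
    fun t w => ∑ j ∈ (B.repr (c t)).support, (B.repr (c t) j : ℝ) * w j
  have hF : ∀ t, Continuous (F t) := fun t => by fun_prop
  have hopen : IsOpen (⋂ t, {w | 0 < F t w}) :=
    isOpen_iInter_of_finite fun t => isOpen_lt continuous_const (hF t)
  have hB : (fun j => B j) ∈ ⋂ t, {w | 0 < F t w} := by
    refine Set.mem_iInter.2 fun t => ?_
    have : F t (fun j => B j) = c t := by
      conv_rhs => rw [← B.linearCombination_repr (c t)]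
      rw [Finsupp.linearCombination_apply, Finsupp.sum]
      simp only [F, Rat.smul_def]
    rw [Set.mem_ofPred_eq, this]
    exact hc t
  have hd : DenseRange (Pi.map fun (_ : Module.Basis.ofVectorSpaceIndex ℚ ℝ) (q : ℚ) => (q : ℝ)) :=
    DenseRange.piMap fun _ => Rat.denseRange_cast
  obtain ⟨w, hw⟩ := hd.exists_mem_open hopen ⟨_, hB⟩
  refine ⟨B.constr ℚ w, fun t => ?_⟩
  have h := Set.mem_iInter.1 hw t
  change 0 < F t _ at h
  rw [B.constr_apply, Finsupp.sum]
  simp only [F, Pi.map, smul_eq_mul] at h ⊢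
  exact_mod_cast h

/-- Potentials for sequences of reals along an ultrafilter, compatible with all limits of
differences modulo integer multiples of `n`. -/
theorem exists_potential {U : Ultrafilter ℕ} (hU : (U : Filter ℕ) ≤ atTop) :
    ∃ Γ : (ℕ → ℝ) → ℝ, ∀ (f g : ℕ → ℝ) (a : ℝ) (z : ℕ → ℤ),
      Tendsto (fun n => f n - g n - n * z n) U (𝓝 a) → a = Γ f - Γ g := by
  let s : Setoid (ℕ → ℝ) :=
    { r := fun f g => ∃ (K : ℝ) (z : ℕ → ℤ), ∀ᶠ n in U, |f n - g n - n * z n| ≤ K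
      iseqv := by
        refine ⟨fun f => ⟨0, 0, by simp⟩, ?_, ?_⟩
        · rintro f g ⟨K, z, h⟩
          refine ⟨K, -z, h.mono fun n hn => ?_⟩
          rw [← abs_neg]
          convert hn using 2
          simp only [Pi.neg_apply, Int.cast_neg]
          ring
        · rintro f g h ⟨K, z, h1⟩ ⟨K', z', h2⟩
          refine ⟨K + K', z + z', (h1.and h2).mono fun n hn => ?_⟩
          refine le_trans ?_ ((abs_add_le _ _).trans (add_le_add hn.1 hn.2))
          apply le_of_eq
          simp only [Pi.add_apply, Int.cast_add]
          congr 1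
          ring }
  -- `Γ f` is the limit, modulo multiples of `n`, of `f` minus its class representative.
  let ρ : (ℕ → ℝ) → (ℕ → ℝ) := fun f => (Quotient.mk s f).out
  have hρ : ∀ f, ∃ (b : ℝ) (z : ℕ → ℤ), Tendsto (fun n => f n - ρ f n - n * z n) U (𝓝 b) := by
    intro f
    obtain ⟨K, z, h⟩ : s.r f (ρ f) := s.symm (Quotient.mk_out (s := s) f)
    have hK : ∀ᶠ n in U, f n - ρ f n - n * z n ∈ Set.Icc (-K) K :=
      h.mono fun n hn => abs_le.1 hn
    obtain ⟨b, -, hb⟩ := (isCompact_Icc (a := -K) (b := K)).ultrafilter_le_nhds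
      (U.map fun n => f n - ρ f n - n * z n) (by rwa [le_principal_iff])
    exact ⟨b, z, hb⟩
  choose Γ Z hΓ using hρ
  refine ⟨Γ, fun f g a z h => ?_⟩
  have hfg : ρ f = ρ g := by
    have : s.r f g := by
      refine ⟨|a| + 1, z, ?_⟩
      exact (h.abs.eventually (gt_mem_nhds (lt_add_one _))).mono fun n hn => hn.le
    change (Quotient.mk s f).out = (Quotient.mk s g).out
    rw [Quotient.sound (s := s) this]
  have hlim := ((hΓ f).sub (hΓ g)).sub h
  rw [hfg] at hlim
  have heq : (fun n : ℕ => f n - ρ g n - n * Z f n - (g n - ρ g n - n * Z g n)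
      - (f n - g n - n * z n)) = fun n : ℕ => (n : ℝ) * ((Z g n - Z f n + z n : ℤ) : ℝ) := by
    ext n
    push_cast
    ring
  rw [heq] at hlim
  -- A convergent sequence of integer multiples of `n` vanishes eventually, as `n → ∞` along `U`.
  have hzero : ∀ᶠ n : ℕ in U, (n : ℝ) * ((Z g n - Z f n + z n : ℤ) : ℝ) = 0 := by
    set b := Γ f - Γ g - a
    obtain ⟨m, hm⟩ := exists_nat_gt (|b| + 1)
    filter_upwards [hlim.abs.eventually (gt_mem_nhds (lt_add_one _)), hU (eventually_ge_atTop m)]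
      with n hn hmn
    by_contra hne
    have h1 : (1 : ℝ) ≤ |((Z g n - Z f n + z n : ℤ) : ℝ)| := by
      rw [← Int.cast_abs]
      exact_mod_cast Int.one_le_abs (by rintro h0; exact hne (by rw [h0]; simp))
    rw [abs_mul, Nat.abs_cast] at hn
    have h2 : (m : ℝ) ≤ n := by exact_mod_cast hmn
    nlinarith [abs_nonneg b]
  have := tendsto_nhds_unique (hlim.congr' hzero) tendsto_const_nhds
  linarith

/-- A total preorder on a finite type is given by a rank function to `ℕ`. -/
theorem exists_rank {ι : Type*} [Finite ι] (R : ι → ι → Prop)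
    (htrans : ∀ i j k, R i j → R j k → R i k) (htotal : ∀ i j, R i j ∨ R j i) :
    ∃ r : ι → ℕ, ∀ i j, r i ≤ r j ↔ R i j := by
  -- The rank counts the elements strictly below `i`.
  refine ⟨fun i => {x | ¬ R i x}.ncard, fun i j => ⟨fun h => ?_, fun h => ?_⟩⟩
  · by_contra hij
    refine absurd h (not_le.2 (Set.ncard_lt_ncard ?_ (Set.toFinite _)))
    have hji := (htotal i j).resolve_left hij
    refine ⟨fun x (hx : ¬ _) hix => hx (htrans _ _ _ hji hix), fun hsub => ?_⟩
    exact hsub (a := j) hij ((htotal j j).elim id id)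
  · exact Set.ncard_le_ncard (fun x (hx : ¬ _) hjx => hx (htrans _ _ _ h hjx)) (Set.toFinite _)

/-- A finite colouring of the positive integers by the logarithm modulo `n`. -/
theorem exists_log_colouring (n : ℕ) (hn : 0 < n) : ∃ (r : ℕ) (φ : ℕ+ → Fin r), ∀ x y, φ x = φ y →
    ∃ z : ℤ, |Real.log (x : ℕ) - Real.log (y : ℕ) - n * z| ≤ 1 / n := by
  have : NeZero (n ^ 2) := ⟨by positivity⟩
  -- In steps of `1/n`, a period of length `n` has `n ^ 2` steps.
  refine ⟨_, fun x => Finite.equivFin (ZMod (n ^ 2)) (⌊n * Real.log (x : ℕ)⌋ : ℤ), fun x y h => ?_⟩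
  rw [(Finite.equivFin _).injective.eq_iff, ZMod.intCast_eq_intCast_iff_dvd_sub] at h
  obtain ⟨z, hz⟩ := h
  have hz' := congrArg (Int.cast (R := ℝ)) hz
  push_cast at hz'
  refine ⟨-z, ?_⟩
  have hn' : (0 : ℝ) < n := by exact_mod_cast hn
  have h1 := Int.floor_le (n * Real.log (x : ℕ))
  have h2 := Int.lt_floor_add_one (n * Real.log (x : ℕ))
  have h3 := Int.floor_le (n * Real.log (y : ℕ))
  have h4 := Int.lt_floor_add_one (n * Real.log (y : ℕ))
  rw [le_div_iff₀ hn', ← abs_of_pos hn', ← abs_mul, abs_of_pos hn', abs_le]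
  push_cast
  constructor <;> nlinarith

/-- A multiply kernel partition regular tuple of matrices satisfies a real weighted form of the
columns condition, with a single positive weight for each of the matrices. -/
theorem MultiplyKPR.exists_real_weights {u k : ℕ} {v : Fin k → ℕ} (hv : ∀ t, 0 < v t)
    {A : ∀ t : Fin k, Matrix (Fin u) (Fin (v t)) ℚ} (hA : MultiplyKPR A) :
    ∃ (c : Fin k → ℝ) (r : (Σ t, Fin (v t)) → ℕ), (∀ t, 0 < c t) ∧
      ∀ (l : ℕ) (f : (Fin u → ℚ) →ₗ[ℚ] ℚ), (∀ i, l < r i → f ((A i.1).col i.2) = 0) →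
        ∑ i with r i = l, c i.1 * (f ((A i.1).col i.2) : ℝ) = 0 := by
  classical
  have hsol : ∀ n : ℕ, ∃ x : (Σ t, Fin (v t)) → ℕ+, (∀ i j, i.1 = j.1 → ∃ z : ℤ,
      |Real.log (x i : ℕ) - Real.log (x j : ℕ) - (n + 1 : ℕ) * z| ≤ 1 / (n + 1 : ℕ)) ∧
      ∑ i, posToRat (x i) • (A i.1).col i.2 = 0 := by
    intro n
    obtain ⟨r, φ, hφ⟩ := exists_log_colouring (n + 1) n.succ_pos
    obtain ⟨x, hx, hx0⟩ := hA r φ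
    refine ⟨fun i => x i.1 i.2, ?_, ?_⟩
    · rintro ⟨t, i⟩ ⟨s, j⟩ (rfl : t = s)
      exact hφ _ _ (hx t i j)
    · rw [← hx0, Fintype.sum_sigma]
      refine Finset.sum_congr rfl fun t _ => ?_
      ext a
      simp [Matrix.mulVec, dotProduct, mul_comm]
  choose x hx hx0 using hsol
  let U : Ultrafilter ℕ := Filter.hyperfilter ℕ
  have hU : (U : Filter ℕ) ≤ atTop := Nat.hyperfilter_le_atTop
  -- The shift pairs `L i n` with modulus `n`, since `x n` was found for modulus `n + 1`.
  let L : (Σ t, Fin (v t)) → ℕ → ℝ := fun i n => Real.log (x (n - 1) i : ℕ)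
  have hL : ∀ i n, Real.exp (L i n) = (x (n - 1) i : ℕ) := fun i n =>
    Real.exp_log (by exact_mod_cast (x _ i).pos)
  obtain ⟨Γ, hΓ⟩ := exists_potential hU
  have hΓ1 : ∀ i j, i.1 = j.1 → Γ (L i) = Γ (L j) := by
    intro i j hij
    choose z hz using fun n => hx n i j hij
    have := hΓ (L i) (L j) 0 (fun n => z (n - 1)) (by
      rw [tendsto_zero_iff_abs_tendsto_zero]
      refine tendsto_of_tendsto_of_tendsto_of_le_of_le' tendsto_const_nhds
        (tendsto_one_div_atTop_nhds_zero_nat.mono_left hU)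
        (Eventually.of_forall fun n => abs_nonneg _) ?_
      filter_upwards [hU (eventually_ge_atTop 1)] with n hn
      have := hz (n - 1)
      rwa [Nat.sub_add_cancel hn] at this)
    linarith
  obtain ⟨r, hr⟩ := exists_rank (fun i j => ∃ K, ∀ᶠ n in U, L i n - L j n ≤ K)
    (by
      rintro i j k ⟨K, h⟩ ⟨K', h'⟩
      exact ⟨K + K', (h.and h').mono fun n hn => by linarith [hn.1, hn.2]⟩)
    (by
      intro i j
      by_cases h : ∀ᶠ n in U, L i n - L j n ≤ 0
      · exact Or.inl ⟨0, h⟩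
      · rw [← Ultrafilter.eventually_not] at h
        exact Or.inr ⟨0, h.mono fun n hn => by linarith⟩)
  have hlt : ∀ i j, r i < r j → Tendsto (fun n => Real.exp (L i n - L j n)) U (𝓝 0) := by
    intro i j hij
    refine Real.tendsto_exp_atBot.comp (tendsto_atBot.2 fun K => ?_)
    by_contra h
    rw [← Ultrafilter.eventually_not] at h
    exact absurd ((hr j i).2 ⟨-K, h.mono fun n hn => by linarith⟩) (not_le.2 hij)
  have heq : ∀ i j, r i = r j →
      Tendsto (fun n => Real.exp (L i n - L j n)) U (𝓝 (Real.exp (Γ (L i) - Γ (L j)))) := by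
    intro i j hij
    refine (Real.continuous_exp.tendsto _).comp ?_
    obtain ⟨K, hK⟩ := (hr i j).1 hij.le
    obtain ⟨K', hK'⟩ := (hr j i).1 hij.ge
    obtain ⟨b, -, hb⟩ := (isCompact_Icc (a := -K') (b := K)).ultrafilter_le_nhds
      (U.map fun n => L i n - L j n) (by
        rw [le_principal_iff]
        exact (hK.and hK').mono fun n hn => ⟨by linarith [hn.2], hn.1⟩)
    have hb' : Tendsto (fun n => L i n - L j n) U (𝓝 b) := hb
    rwa [hΓ (L i) (L j) b 0 (by simpa using hb')] at hb'
  refine ⟨fun t => Real.exp (Γ (L ⟨t, 0, hv t⟩)), r, fun t => Real.exp_pos _, fun l f hf => ?_⟩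
  have hc : ∀ i : (Σ t, Fin (v t)), Real.exp (Γ (L ⟨i.1, 0, hv i.1⟩)) = Real.exp (Γ (L i)) :=
    fun i => by rw [hΓ1 ⟨i.1, 0, hv i.1⟩ i rfl]
  simp only [hc]
  by_cases hl : ∃ i₀, r i₀ = l
  swap
  · rw [Finset.filter_false_of_mem (fun i _ hi => hl ⟨i, hi⟩), Finset.sum_empty]
  obtain ⟨i₀, rfl⟩ := hl
  -- After division by the variable of `i₀`, slower columns vanish in the limit and `f` kills the
  -- faster ones.
  have hlim : Tendsto (fun n => ∑ i, Real.exp (L i n - L i₀ n) * (f ((A i.1).col i.2) : ℝ)) U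
      (𝓝 (∑ i, if r i = r i₀ then
        Real.exp (Γ (L i) - Γ (L i₀)) * (f ((A i.1).col i.2) : ℝ) else 0)) := by
    refine tendsto_finsetSum _ fun i _ => ?_
    rcases lt_trichotomy (r i) (r i₀) with h | h | h
    · simpa [h.ne] using (hlt i i₀ h).mul_const (f ((A i.1).col i.2) : ℝ)
    · simpa [h] using (heq i i₀ h).mul_const (f ((A i.1).col i.2) : ℝ)
    · simp [h.ne', hf i h]
  have hz : ∀ n, ∑ i, Real.exp (L i n - L i₀ n) * (f ((A i.1).col i.2) : ℝ) = 0 := by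
    intro n
    have h0 := congrArg (fun w => ((f w : ℚ) : ℝ)) (hx0 (n - 1))
    simp only [map_sum, map_smul, smul_eq_mul, map_zero, Rat.cast_sum, Rat.cast_mul, Rat.cast_zero,
      posToRat, Rat.cast_natCast] at h0
    simp only [Real.exp_sub, hL, div_mul_eq_mul_div, ← Finset.sum_div, h0, zero_div]
  simp only [hz] at hlim
  have h := tendsto_nhds_unique hlim tendsto_const_nhds
  rw [← Finset.sum_filter] at h
  have h' : Real.exp (Γ (L i₀)) * ∑ i with r i = r i₀, Real.exp (Γ (L i) - Γ (L i₀)) *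
      (f ((A i.1).col i.2) : ℝ) = 0 := by rw [h, mul_zero]
  rw [← h', Finset.mul_sum]
  refine Finset.sum_congr rfl fun i _ => ?_
  rw [← mul_assoc, ← Real.exp_add]
  congr 2
  ring

/-- The columns condition with rational weights for multiply kernel partition regular tuples. -/
theorem MultiplyKPR.exists_columns_condition {u k : ℕ} {v : Fin k → ℕ} (hv : ∀ t, 0 < v t)
    {A : ∀ t : Fin k, Matrix (Fin u) (Fin (v t)) ℚ} (hA : MultiplyKPR A) (t₀ : Fin k) :
    ∃ (c : Fin k → ℚ) (r : (Σ t, Fin (v t)) → ℕ), (∀ t, 0 < c t) ∧ c t₀ = 1 ∧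
      ∀ l, ∑ i with r i = l, c i.1 • (A i.1).col i.2 ∈
        Submodule.span ℚ ((fun i : Σ t, Fin (v t) => c i.1 • (A i.1).col i.2) '' {i | l < r i}) := by
  obtain ⟨c, r, hc, hr⟩ := hA.exists_real_weights hv
  obtain ⟨g, hg⟩ := exists_rat_linear_pos c hc
  have hpos : ∀ t, 0 < g (c t) / g (c t₀) := fun t => div_pos (hg t) (hg t₀)
  refine ⟨fun t => g (c t) / g (c t₀), r, hpos, div_self (hg t₀).ne', fun l => ?_⟩
  rw [← Subspace.forall_mem_dualAnnihilator_apply_eq_zero_iff]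
  intro f hf
  rw [Submodule.mem_dualAnnihilator] at hf
  -- The values of `f` on columns are rational, so `g` acts only on the weights.
  have h0 := congrArg g (hr l f fun i hi => by
    have := hf _ (Submodule.subset_span ⟨i, hi, rfl⟩)
    rw [map_smul, smul_eq_mul] at this
    exact (mul_eq_zero.1 this).resolve_left (hpos i.1).ne')
  have hsmul : ∀ (a : ℝ) (b : ℚ), g (a * b) = b * g a := by
    intro a b
    rw [mul_comm, ← Rat.smul_def, map_smul, smul_eq_mul]
  simp only [map_sum, map_zero, hsmul, map_smul, smul_eq_mul] at h0 ⊢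
  rw [← zero_div (g (c t₀)), ← h0, Finset.sum_div]
  refine Finset.sum_congr rfl fun i _ => ?_
  ring

/-! ### The two implications. -/

/-- Take for `C t` a colour class in `q t`; the monochromatic solution is `c_t x_t`, not `x_t`. -/
theorem SolvableInMembers.multiplyKPR {u k : ℕ} {v : Fin k → ℕ}
    {A : ∀ t : Fin k, Matrix (Fin u) (Fin (v t)) ℚ} {c : Fin k → ℚ} {q : Fin k → Ultrafilter ℕ+}
    (h : SolvableInMembers A c q) : MultiplyKPR A := by
  intro m φ
  have hcol : ∀ t, ∃ d : Fin m, φ ⁻¹' {d} ∈ q t := by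
    intro t
    obtain ⟨d, hd⟩ := Ultrafilter.eq_pure_of_finite ((q t).map φ)
    refine ⟨d, ?_⟩
    rw [← Ultrafilter.mem_map, hd]
    simp
  choose d hd using hcol
  obtain ⟨x, -, hx, h0⟩ := h _ hd
  choose y hy hyx using hx
  refine ⟨y, fun t i j => ?_, ?_⟩
  · rw [hy t i, hy t j]
  · rw [← h0]
    refine Finset.sum_congr rfl fun t _ => ?_
    congr 1
    ext j
    exact hyx t j

theorem MultiplyKPR.exists_solvableInMembers {u k : ℕ} {v : Fin k → ℕ} (hv : ∀ t, 0 < v t)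
    {A : ∀ t : Fin k, Matrix (Fin u) (Fin (v t)) ℚ} (hA : MultiplyKPR A) (t₀ : Fin k)
    {p : Ultrafilter ℕ+} (hp : IsMinimalIdempotent p) :
    ∃ (c : Fin k → ℚ) (q : Fin k → Ultrafilter ℕ+),
      (∀ t, 0 < c t) ∧ c t₀ = 1 ∧ (∀ t, IsMinimalIdempotent (q t)) ∧ q t₀ = p ∧
      (∀ t, (q t).map posToRat = ratMul (c t) p) ∧ SolvableInMembers A c q := by
  obtain ⟨c, r, hc, hc0, hr⟩ := hA.exists_columns_condition hv t₀
  choose q hq hqp using fun t => hp.exists_map_eq_ratMul (hc t)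
  refine ⟨c, q, hc, hc0, hq, ?_, hqp, fun C hC => ?_⟩
  · apply Ultrafilter.map_injective posToRat_injective
    rw [hqp, hc0, ratMul]
    simp only [one_mul]
  -- Since `q s` is `c s` times `p`, each dilated set belongs to the same `p`.
  · have hmem : (⋂ s, invDilate (c s) (C s)) ∈ p := by
      refine (Filter.iInter_mem (f := (p : Filter ℕ+))).2 fun s => ?_
      have : posToRat '' C s ∈ (q s).map posToRat := Filter.image_mem_map (hC s)
      rw [hqp] at this
      exact this
    obtain ⟨x, hx, hx0⟩ := hp.exists_solution _ r hr hmem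
    refine ⟨fun t j => x ⟨t, j⟩, fun t j => hx _, fun t j => ?_, ?_⟩
    · exact Set.mem_iInter.1 (hx ⟨t, j⟩) t
    · rw [← hx0, Fintype.sum_sigma]
      refine Finset.sum_congr rfl fun t _ => ?_
      ext a
      simp only [Matrix.mulVec, dotProduct, Pi.smul_apply, smul_eq_mul, Finset.sum_apply,
        Matrix.col_apply]
      exact Finset.sum_congr rfl fun j _ => by ring

theorem theorem3p7 (u k : ℕ) (hu : 0 < u) (hk : 2 ≤ k) (v : Fin k → ℕ) (hv : ∀ t, 0 < v t)
    (p : Ultrafilter ℕ+) (hp : IsMinimalIdempotent p)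
    (A : ∀ t : Fin k, Matrix (Fin u) (Fin (v t)) ℚ) :
    (MultiplyKPR A ↔
      ∃ (c : Fin k → ℚ) (q : Fin k → Ultrafilter ℕ+),
        (∀ t, 0 < c t) ∧ c ⟨0, by omega⟩ = 1 ∧
        (∀ t, IsMinimalIdempotent (q t)) ∧ q ⟨0, by omega⟩ = p ∧
        SolvableInMembers A c q) ∧
    (MultiplyKPR A →
      ∃ (c : Fin k → ℚ) (q : Fin k → Ultrafilter ℕ+),
        (∀ t, 0 < c t) ∧ c ⟨0, by omega⟩ = 1 ∧
        (∀ t, IsMinimalIdempotent (q t)) ∧ q ⟨0, by omega⟩ = p ∧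
        (∀ t, (q t).map posToRat = ratMul (c t) p) ∧
        SolvableInMembers A c q) := by
  refine ⟨⟨fun hA => ?_, ?_⟩, fun hA => hA.exists_solvableInMembers hv _ hp⟩
  · obtain ⟨c, q, h1, h2, h3, h4, -, h6⟩ := hA.exists_solvableInMembers hv ⟨0, by omega⟩ hp
    exact ⟨c, q, h1, h2, h3, h4, h6⟩
  · rintro ⟨c, q, -, -, -, -, h⟩
    exact h.multiplyKPR
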